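/- Let $d\ge 1$, let $g\in L^2(\mathbb R^d)$, and let $a=p/q$, where $0<p<q$ are coprime integers. Write $$\mathcal G(g,a,1)=\{e^{2\pi i\langle m,x\rangle}g(x-na): m,n\in\mathbb Z^d\}.$$ Let $Zg$ be the Zak transform of $g$, that is, $$Zg(x,t)=\sum_{k\in\mathbb Z^d}g(x-k)e^{2\pi i\langle k,t\rangle}$$ with convergence in $L^2([0,1]^{2d})$, extended to $\mathbb R^{2d}$ by quasiperiodicity: $Zg(x,t+n)=Zg(x,t)$ and $Zg(x+n,t)=e^{2\pi i\langle n,t\rangle}Zg(x,t)$ for all $n\in\mathbb Z^d$. For $j\in\{0,\dots,q-1\}^d$ put $g_j(x,t)=Zg\left(x-\tfrac pq j,\,t\right)$. (i) If $\mathcal G(g,a,1)$ is a frame for $L^2(\mathbb R^d)$ (that is, there are constants $A',B'>0$ such that $A'\|f\|^2\le\sum_{\varphi\in\mathcal G(g,a,1)}|\langle f,\varphi\rangle|^2\le B'\|f\|^2$ for all $f\in L^2(\mathbb R^d)$), then there exist constants $A,B$ such that $$0<A\le\max_{j\in\{0,\dots,q-1\}^d}|g_j(x,t)|\le B<\infty\quad\text{for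 a.e. }(x,t)\in[0,1]^{2d}.$$ (ii) If $a=1/q$, the converse also holds: if there exist constants $A,B$ for which this inequality holds, then $\mathcal G(g,a,1)$ is a frame for $L^2(\mathbb R^d)$. -/

import Mathlib

open MeasureTheory
open scoped ENNReal

namespace GaborZak

/-- A family `φ` in a complex Hilbert space `H` is a frame if there are constants `A, B > 0` with
`A ‖f‖² ≤ ∑ᵢ |⟨f, φᵢ⟩|² ≤ B ‖f‖²` for all `f ∈ H` (the sum being convergent). -/
def IsFrame {ι H : Type*} [NormedAddCommGroup H] [InnerProductSpace ℂ H] (φ : ι → H) : Prop :=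
  ∃ A B : ℝ, 0 < A ∧ 0 < B ∧ ∀ f : H,
    Summable (fun i => ‖inner ℂ (φ i) f‖ ^ 2) ∧
    A * ‖f‖ ^ 2 ≤ ∑' i, ‖inner ℂ (φ i) f‖ ^ 2 ∧
    ∑' i, ‖inner ℂ (φ i) f‖ ^ 2 ≤ B * ‖f‖ ^ 2

/-- `e^{2πi⟨u, t⟩}` for `u, t ∈ ℝ^d`. -/
noncomputable def expo {d : ℕ} (u t : Fin d → ℝ) : ℂ :=
  Complex.exp (2 * Real.pi * Complex.I * ((∑ i, u i * t i : ℝ) : ℂ))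

/-- The inclusion `ℤ^d → ℝ^d`. -/
def ofInt {d : ℕ} (k : Fin d → ℤ) : Fin d → ℝ := fun i => (k i : ℝ)

/-- The cube `[0,1]^d`. -/
def cube (d : ℕ) : Set (Fin d → ℝ) := Set.Icc 0 1

/-- Lebesgue measure on `[0,1]^{2d} = [0,1]^d × [0,1]^d`. -/
noncomputable def cubeMeasure (d : ℕ) : Measure ((Fin d → ℝ) × (Fin d → ℝ)) :=
  volume.restrict (cube d ×ˢ cube d)

theorem norm_expo {d : ℕ} (u t : Fin d → ℝ) : ‖expo u t‖ = 1 := by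
  have h : expo u t = Complex.exp (((2 * Real.pi * ∑ i, u i * t i : ℝ) : ℂ) * Complex.I) := by
    unfold expo
    congr 1
    push_cast
    ring
  rw [h, Complex.norm_exp_ofReal_mul_I]

theorem continuous_expo {d : ℕ} (u : Fin d → ℝ) : Continuous (expo u) := by
  unfold expo
  fun_prop

theorem cubeMeasure_eq (d : ℕ) :
    cubeMeasure d = ((volume : Measure (Fin d → ℝ)).restrict (cube d)).prod
      ((volume : Measure (Fin d → ℝ)).restrict (cube d)) := by
  unfold cubeMeasure
  rw [Measure.prod_restrict]
  rfl

instance instFiniteCube (d : ℕ) :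
    IsFiniteMeasure ((volume : Measure (Fin d → ℝ)).restrict (cube d)) := by
  refine ⟨?_⟩
  rw [Measure.restrict_apply_univ]
  exact isCompact_Icc.measure_lt_top

theorem memLp_translate {d : ℕ} (f : Lp ℂ 2 (volume : Measure (Fin d → ℝ))) (c : Fin d → ℝ) :
    MemLp (fun x => f (x - c)) 2 (volume : Measure (Fin d → ℝ)) :=
  (Lp.memLp f).comp_measurePreserving (measurePreserving_sub_right volume c)

/-- The time-frequency shift `x ↦ e^{2πi⟨mb, x⟩} g(x - na)`. -/
noncomputable def gaborFun {d : ℕ} (g : Lp ℂ 2 (volume : Measure (Fin d → ℝ))) (a b : ℝ)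
    (m n : Fin d → ℤ) (x : Fin d → ℝ) : ℂ :=
  expo (b • ofInt m) x * g (x - a • ofInt n)

theorem memLp_gaborFun {d : ℕ} (g : Lp ℂ 2 (volume : Measure (Fin d → ℝ))) (a b : ℝ)
    (m n : Fin d → ℤ) : MemLp (gaborFun g a b m n) 2 (volume : Measure (Fin d → ℝ)) := by
  have h := memLp_translate g (a • ofInt n)
  refine h.of_le ((continuous_expo _).aestronglyMeasurable.mul h.1) ?_
  filter_upwards with x
  simp [gaborFun, norm_expo]

/-- The Gabor system `𝒢(g,a,b) = {e^{2πi⟨mb, x⟩} g(x - na) : m, n ∈ ℤ^d}` in `L²(ℝ^d)`. -/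
noncomputable def gaborSystem {d : ℕ} (g : Lp ℂ 2 (volume : Measure (Fin d → ℝ))) (a b : ℝ)
    (mn : (Fin d → ℤ) × (Fin d → ℤ)) : Lp ℂ 2 (volume : Measure (Fin d → ℝ)) :=
  (memLp_gaborFun g a b mn.1 mn.2).toLp (gaborFun g a b mn.1 mn.2)

/-- The `k`-th term `(x, t) ↦ f(x - k) e^{2πi⟨k, t⟩}` of the Zak series. -/
noncomputable def zakTermFun {d : ℕ} (f : Lp ℂ 2 (volume : Measure (Fin d → ℝ)))
    (k : Fin d → ℤ) (z : (Fin d → ℝ) × (Fin d → ℝ)) : ℂ :=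
  f (z.1 - ofInt k) * expo (ofInt k) z.2

theorem memLp_zakTermFun {d : ℕ} (f : Lp ℂ 2 (volume : Measure (Fin d → ℝ)))
    (k : Fin d → ℤ) : MemLp (zakTermFun f k) 2 (cubeMeasure d) := by
  rw [cubeMeasure_eq]
  have h := ((memLp_translate f (ofInt k)).restrict (cube d)).comp_fst
    ((volume : Measure (Fin d → ℝ)).restrict (cube d))
  refine h.of_le (h.1.mul
    ((continuous_expo (ofInt k)).comp continuous_snd).aestronglyMeasurable) ?_
  filter_upwards with x
  simp [zakTermFun, norm_expo]

/-- The `k`-th term of the Zak series as an element of `L²([0,1]^{2d})`. -/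
noncomputable def zakTerm {d : ℕ} (f : Lp ℂ 2 (volume : Measure (Fin d → ℝ)))
    (k : Fin d → ℤ) : Lp ℂ 2 (cubeMeasure d) :=
  (memLp_zakTermFun f k).toLp (zakTermFun f k)

/-- The Zak transform `Zf(x,t) = ∑_{k ∈ ℤ^d} f(x - k) e^{2πi⟨k, t⟩}` as an element of
`L²([0,1]^{2d})`; the series converges unconditionally in `L²([0,1]^{2d})`
(see `summable_zakTerm`). -/
noncomputable def zakCube {d : ℕ} (f : Lp ℂ 2 (volume : Measure (Fin d → ℝ))) :
    Lp ℂ 2 (cubeMeasure d) :=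
  ∑' k : Fin d → ℤ, zakTerm f k

/-- The quasiperiodic extension of the Zak transform to `ℝ^{2d}`, i.e. the function with
`Zf(x + n, t) = e^{2πi⟨n, t⟩} Zf(x, t)` and `Zf(x, t + n) = Zf(x, t)` for `n ∈ ℤ^d`. -/
noncomputable def zak {d : ℕ} (f : Lp ℂ 2 (volume : Measure (Fin d → ℝ)))
    (x t : Fin d → ℝ) : ℂ :=
  expo (ofInt fun i => ⌊x i⌋) t * zakCube f (fun i => Int.fract (x i), fun i => Int.fract (t i))

theorem expo_add_left {d : ℕ} (u v t : Fin d → ℝ) : expo (u + v) t = expo u t * expo v t := by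
  unfold expo
  rw [← Complex.exp_add]
  congr 1
  simp only [Pi.add_apply, add_mul, Finset.sum_add_distrib]
  push_cast
  ring

theorem expo_ofInt_add {d : ℕ} (k n : Fin d → ℤ) (t : Fin d → ℝ) :
    expo (ofInt k) (t + ofInt n) = expo (ofInt k) t := by
  unfold expo
  rw [Complex.exp_eq_exp_iff_exists_int]
  refine ⟨∑ i, k i * n i, ?_⟩
  simp only [Pi.add_apply, ofInt, mul_add, Finset.sum_add_distrib]
  push_cast
  ring

theorem zak_add_left {d : ℕ} (f : Lp ℂ 2 (volume : Measure (Fin d → ℝ)))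
    (x t : Fin d → ℝ) (n : Fin d → ℤ) :
    zak f (x + ofInt n) t = expo (ofInt n) t * zak f x t := by
  unfold zak
  have h : (ofInt fun i => ⌊(x + ofInt n) i⌋) = ofInt n + ofInt (fun i => ⌊x i⌋) := by
    funext i
    simp [ofInt, add_comm]
  rw [h, expo_add_left]
  simp [ofInt, mul_assoc]

theorem zak_add_right {d : ℕ} (f : Lp ℂ 2 (volume : Measure (Fin d → ℝ)))
    (x t : Fin d → ℝ) (n : Fin d → ℤ) : zak f x (t + ofInt n) = zak f x t := by
  unfold zak
  rw [expo_ofInt_add]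
  simp [ofInt]

theorem integral_exp_int (n : ℤ) (hn : n ≠ 0) :
    ∫ s in Set.Icc (0 : ℝ) 1, Complex.exp (2 * Real.pi * Complex.I * n * s) = 0 := by
  rw [integral_Icc_eq_integral_Ioc, ← intervalIntegral.integral_of_le zero_le_one,
    integral_exp_mul_complex]
  · have h : Complex.exp (2 * Real.pi * Complex.I * n) = 1 := by
      rw [Complex.exp_eq_one_iff]
      exact ⟨n, by ring⟩
    simp [h]
  · simp [Real.pi_ne_zero, hn]

theorem integral_expo_int {d : ℕ} (n : Fin d → ℤ) (hn : n ≠ 0) :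
    ∫ t in cube d, expo (ofInt n) t = 0 := by
  obtain ⟨i, hi⟩ := Function.ne_iff.1 hn
  have h1 : ∀ t : Fin d → ℝ, expo (ofInt n) t =
      ∏ i, Complex.exp (2 * Real.pi * Complex.I * (n i) * (t i)) := by
    intro t
    rw [← Complex.exp_sum]
    unfold expo ofInt
    congr 1
    push_cast
    rw [Finset.mul_sum]
    exact Finset.sum_congr rfl fun _ _ => by ring
  have h2 : (volume : Measure (Fin d → ℝ)).restrict (cube d) =
      Measure.pi fun _ => (volume : Measure ℝ).restrict (Set.Icc 0 1) := by
    rw [← Measure.restrict_pi_pi, Set.pi_univ_Icc]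
    rfl
  simp_rw [h1]
  rw [h2, integral_fintype_prod_eq_prod
    (f := fun i s => Complex.exp (2 * Real.pi * Complex.I * (n i) * (s : ℝ)))]
  exact Finset.prod_eq_zero (Finset.mem_univ i) (integral_exp_int _ hi)

theorem inner_zakTerm {d : ℕ} (f : Lp ℂ 2 (volume : Measure (Fin d → ℝ)))
    (k l : Fin d → ℤ) (hkl : k ≠ l) : inner ℂ (zakTerm f k) (zakTerm f l) = 0 := by
  have h0 : inner ℂ (zakTerm f k) (zakTerm f l) =
      ∫ z, (star (f (z.1 - ofInt k)) * f (z.1 - ofInt l)) * expo (ofInt (l - k)) z.2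
        ∂cubeMeasure d := by
    rw [L2.inner_def]
    refine integral_congr_ae ?_
    filter_upwards [(memLp_zakTermFun f k).coeFn_toLp, (memLp_zakTermFun f l).coeFn_toLp]
      with z hk hl
    have hk' : zakTerm f k z = zakTermFun f k z := hk
    have hl' : zakTerm f l z = zakTermFun f l z := hl
    have he : expo (ofInt l) z.2 = expo (ofInt (l - k)) z.2 * expo (ofInt k) z.2 := by
      rw [← expo_add_left]
      congr 1
      funext i
      simp [ofInt]
    have hn : (starRingEnd ℂ) (expo (ofInt k) z.2) * expo (ofInt k) z.2 = 1 := by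
      rw [mul_comm, Complex.mul_conj, Complex.normSq_eq_norm_sq, norm_expo]
      simp
    rw [hk', hl']
    simp only [zakTermFun, RCLike.inner_apply, map_mul, he, Complex.star_def]
    linear_combination ((starRingEnd ℂ) (f (z.1 - ofInt k)) * f (z.1 - ofInt l) *
      expo (ofInt (l - k)) z.2) * hn
  rw [h0, cubeMeasure_eq, integral_prod_mul
    (f := fun x => star (f (x - ofInt k)) * f (x - ofInt l)),
    integral_expo_int _ (sub_ne_zero.2 hkl.symm), mul_zero]

theorem norm_zakTerm_sq {d : ℕ} (f : Lp ℂ 2 (volume : Measure (Fin d → ℝ)))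
    (k : Fin d → ℤ) : ‖zakTerm f k‖ ^ 2 = ∫ x in cube d, ‖f (x - ofInt k)‖ ^ 2 := by
  have hv : (volume : Measure (Fin d → ℝ)).real (cube d) = 1 := by
    simp [cube, Measure.real, Real.volume_Icc_pi]
  have h0 : ‖zakTerm f k‖ ^ 2 = ∫ z, ‖f (z.1 - ofInt k)‖ ^ 2 * 1 ∂cubeMeasure d := by
    have h1 := congrArg RCLike.re (L2.inner_def (𝕜 := ℂ) (zakTerm f k) (zakTerm f k))
    rw [← norm_sq_eq_re_inner (𝕜 := ℂ)] at h1
    rw [h1, ← integral_re (L2.integrable_inner _ _)]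
    refine integral_congr_ae ?_
    filter_upwards [(memLp_zakTermFun f k).coeFn_toLp] with z hk
    have hk' : zakTerm f k z = zakTermFun f k z := hk
    rw [hk', ← norm_sq_eq_re_inner (𝕜 := ℂ)]
    simp [zakTermFun, norm_expo]
  rw [h0, cubeMeasure_eq,
    integral_prod_mul (f := fun x => ‖f (x - ofInt k)‖ ^ 2) (g := fun _ => (1 : ℝ))]
  simp [hv]

theorem summable_norm_zakTerm_sq {d : ℕ} (f : Lp ℂ 2 (volume : Measure (Fin d → ℝ))) :
    Summable fun k : Fin d → ℤ => ‖zakTerm f k‖ ^ 2 := by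
  set s : (Fin d → ℤ) → Set (Fin d → ℝ) :=
    fun k => {y | y + ofInt k ∈ Set.pi Set.univ fun _ => Set.Ico (0 : ℝ) 1} with hs
  have hcube : (Set.pi Set.univ fun _ => Set.Ico (0 : ℝ) 1) =ᵐ[volume] cube d :=
    Measure.univ_pi_Ico_ae_eq_Icc
  have hmeas : MeasurableSet (Set.pi Set.univ fun _ : Fin d => Set.Ico (0 : ℝ) 1) :=
    MeasurableSet.univ_pi fun _ => measurableSet_Ico
  have hsm : ∀ k, MeasurableSet (s k) := fun k => (measurable_add_const (ofInt k)) hmeas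
  have hd : Pairwise (Function.onFun Disjoint s) := by
    intro k l hkl
    refine Set.disjoint_left.2 fun y hk hl => hkl ?_
    funext i
    have h1 := hk i (Set.mem_univ i)
    have h2 := hl i (Set.mem_univ i)
    have h3 : ⌊-(y i)⌋ ≤ k i ∧ ⌊-(y i)⌋ ≤ l i := by
      simp only [ofInt, Pi.add_apply, Set.mem_Ico] at h1 h2
      constructor
      · have : ((⌊-(y i)⌋ : ℤ) : ℝ) ≤ k i := (Int.floor_le _).trans (by linarith [h1.1])
        exact_mod_cast this
      · have : ((⌊-(y i)⌋ : ℤ) : ℝ) ≤ l i := (Int.floor_le _).trans (by linarith [h2.1])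
        exact_mod_cast this
    simp only [ofInt, Pi.add_apply, Set.mem_Ico] at h1 h2
    have h4 : ((k i : ℤ) : ℝ) < l i + 1 := by linarith [h1.2, h2.1]
    have h5 : ((l i : ℤ) : ℝ) < k i + 1 := by linarith [h2.2, h1.1]
    have h6 : k i < l i + 1 := by exact_mod_cast h4
    have h7 : l i < k i + 1 := by exact_mod_cast h5
    omega
  have hint : Integrable (fun x => ‖f x‖ ^ 2) volume :=
    (memLp_two_iff_integrable_sq_norm (Lp.memLp f).1).1 (Lp.memLp f)
  have hsum := (hasSum_integral_iUnion hsm hd hint.integrableOn).summable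
  refine hsum.congr fun k => ?_
  have h := (measurePreserving_add_right volume (ofInt k)).setIntegral_preimage_emb
    (measurableEmbedding_addRight (ofInt k)) (fun x => ‖f (x - ofInt k)‖ ^ 2)
    (Set.pi Set.univ fun _ => Set.Ico (0 : ℝ) 1)
  rw [norm_zakTerm_sq, ← setIntegral_congr_set hcube, ← h]
  simp only [add_sub_cancel_right]
  rfl

theorem summable_zakTerm {d : ℕ} (f : Lp ℂ 2 (volume : Measure (Fin d → ℝ))) :
    Summable fun k : Fin d → ℤ => zakTerm f k := by
  have hV : OrthogonalFamily ℂ (fun k : Fin d → ℤ => ↥(ℂ ∙ zakTerm f k))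
      fun k => (ℂ ∙ zakTerm f k).subtypeₗᵢ := by
    intro k l hkl v w
    obtain ⟨a, ha⟩ := Submodule.mem_span_singleton.1 v.2
    obtain ⟨b, hb⟩ := Submodule.mem_span_singleton.1 w.2
    simp [← ha, ← hb, inner_smul_left, inner_smul_right, inner_zakTerm f k l hkl]
  have h := (hV.summable_iff_norm_sq_summable
    (fun k => ⟨zakTerm f k, Submodule.mem_span_singleton_self _⟩)).2
    (by simpa using summable_norm_zakTerm_sq f)
  simpa using h

/-- The functions `g_j(x, t) = Zg(x - (p/q) j, t)`, `j ∈ {0, …, q-1}^d`. -/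
noncomputable def zakWindow {d : ℕ} (g : Lp ℂ 2 (volume : Measure (Fin d → ℝ))) (p q : ℕ)
    (j : Fin d → Fin q) (z : (Fin d → ℝ) × (Fin d → ℝ)) : ℂ :=
  zak g (fun i => z.1 i - (p : ℝ) / (q : ℝ) * ((j i : ℕ) : ℝ)) z.2

end GaborZak

namespace GaborZak

/-! The Zak transform is a unitary map onto `L²([0,1]^{2d})` which turns Gabor coefficients into
Fourier coefficients. Write `n = r - q l` with `r ∈ {0,…,q-1}^d`. Then `(p/q) n` and `(p/q) r`
differ by the integer vector `p l`, so by quasiperiodicity `⟨f, φ_{m,n}⟩` is the Fourier coefficient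
of `conj g_r · Zf` at `(m, p l)` (`inner_gaborSystem`).

Only multiples of `p` occur as frequencies in `t`. They satisfy Parseval, with factor `p^{-d}`, for
functions supported where `t` lies in one cube of side `1/p` (`hasSum_sq_cubeCoeff_of_box`). For `f`
whose Zak transform has such support, the frame sum is `p^{-d} ∫ (∑_r |g_r|²) |Zf|²`. Surjectivity
of `Z` allows `Zf` to be any indicator of a set in such a slab, and the frame inequalities then
squeeze `∑_r |g_r|²` between `p^d A` and `p^d B` a.e. Since `max² ≤ ∑ ≤ q^d max²`, this gives (i).

For `p = 1` the slab is the whole cube. The integral formula then holds for every `f`, as soon as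
the `g_r` are bounded, and this gives (ii). -/

/-! ### Parseval's identity on the unit cube -/

/-- The half-open cube `∏ᵢ (0,1]`. -/
def halfCube (ι : Type*) : Set (ι → ℝ) := {x | ∀ i, x i ∈ Set.Ioc (0 : ℝ) 1}

section Torus

-- In this section `volume` on the circle is normalised Haar measure, the one for which Parseval's
-- identity on `UnitAddTorus` is used.
attribute [-instance] AddCircle.measureSpace

noncomputable local instance : MeasureSpace UnitAddCircle := ⟨AddCircle.haarAddCircle⟩

local instance : IsProbabilityMeasure (volume : Measure UnitAddCircle) :=
  inferInstanceAs (IsProbabilityMeasure AddCircle.haarAddCircle)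

theorem hasSum_sq_fourier_halfCube {ι : Type*} [Fintype ι] {h : (ι → ℝ) → ℂ}
    (hh : MemLp h 2 (volume.restrict (halfCube ι))) :
    HasSum (fun n : ι → ℤ => ‖∫ x in halfCube ι,
        (starRingEnd ℂ) (∏ i, Complex.exp (2 * Real.pi * Complex.I * n i * x i)) * h x‖ ^ 2)
      (∫ x in halfCube ι, ‖h x‖ ^ 2) := by
  have hset : halfCube ι = {x : ι → ℝ | ∀ i, x i ∈ Set.Ioc ((0 : ι → ℝ) i) ((0 : ι → ℝ) i + 1)} := by
    simp [halfCube]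
  have hm : MeasurableSet (halfCube ι) := MeasurableSet.univ_pi' fun _ => measurableSet_Ioc
  rw [hset] at hm
  set e := UnitAddTorus.measurableEquivPiIoc (0 : ι → ℝ) with he
  set s : UnitAddTorus ι → (ι → ℝ) := fun θ => (e θ).1 with hs
  have hemb : MeasurableEmbedding s := (MeasurableEmbedding.subtype_coe hm).comp e.measurableEmbedding
  have hmp : MeasurePreserving s volume (volume.restrict (halfCube ι)) := by
    rw [hset]
    refine ⟨hemb.measurable, ?_⟩
    have h0 : Measure.map e volume = Measure.comap Subtype.val volume :=
      (UnitAddTorus.measurePreserving_equivPiIoc (0 : ι → ℝ)).map_eq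
    rw [← map_comap_subtype_coe hm]
    refine Eq.trans ?_ (congrArg (Measure.map Subtype.val) h0)
    exact (Measure.map_map measurable_subtype_coe e.measurable).symm
  have hmk : ∀ θ i, ((s θ i : ℝ) : UnitAddCircle) = θ i := fun θ i =>
    congrFun (e.symm_apply_apply θ) i
  have hH := hh.comp_measurePreserving hmp
  have h1 := UnitAddTorus.hasSum_sq_mFourierCoeff (hH.toLp _)
  have h2 : ∫ θ, ‖hH.toLp _ θ‖ ^ 2 = ∫ x in halfCube ι, ‖h x‖ ^ 2 := by
    rw [← hmp.integral_comp hemb]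
    refine integral_congr_ae ?_
    filter_upwards [hH.coeFn_toLp] with θ hθ
    rw [hθ]
    rfl
  rw [h2] at h1
  refine h1.congr_fun fun n => ?_
  rw [UnitAddTorus.mFourierCoeff, ← hmp.integral_comp hemb]
  congr 2
  refine integral_congr_ae ?_
  filter_upwards [hH.coeFn_toLp] with θ hθ
  rw [hθ, UnitAddTorus.mFourier_neg, smul_eq_mul]
  simp only [Function.comp]
  congr 2
  simp only [UnitAddTorus.mFourier, ContinuousMap.coe_mk]
  refine Finset.prod_congr rfl fun i _ => ?_
  rw [← hmk θ i, fourier_coe_apply]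
  simp

end Torus

theorem expo_eq_prod {d : ℕ} (n : Fin d → ℤ) (t : Fin d → ℝ) :
    expo (ofInt n) t = ∏ i, Complex.exp (2 * Real.pi * Complex.I * (n i) * (t i)) := by
  rw [← Complex.exp_sum]
  unfold expo ofInt
  congr 1
  push_cast
  rw [Finset.mul_sum]
  exact Finset.sum_congr rfl fun _ _ => by ring

theorem halfCube_ae_eq (d : ℕ) : halfCube (Fin d) =ᵐ[volume] cube d := by
  have := Measure.univ_pi_Ioc_ae_eq_Icc (f := (0 : Fin d → ℝ)) (g := 1)
    (μ := fun _ => (volume : Measure ℝ))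
  have h2 : halfCube (Fin d) = Set.univ.pi fun i => Set.Ioc ((0 : Fin d → ℝ) i) ((1 : Fin d → ℝ) i) := by
    ext x
    simp [halfCube]
  rw [h2]
  exact this

/-- The Fourier coefficients on `[0,1]^{2d}`. -/
noncomputable def cubeCoeff {d : ℕ} (h : (Fin d → ℝ) × (Fin d → ℝ) → ℂ)
    (mk : (Fin d → ℤ) × (Fin d → ℤ)) : ℂ :=
  ∫ z, (starRingEnd ℂ) (expo (ofInt mk.1) z.1 * expo (ofInt mk.2) z.2) * h z ∂cubeMeasure d

/-- The pair of `d`-dimensional variables is one variable indexed by `Fin d ⊕ Fin d`, so the torus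
identity applies in dimension `2d`. -/
theorem hasSum_sq_cubeCoeff {d : ℕ} {h : (Fin d → ℝ) × (Fin d → ℝ) → ℂ}
    (hh : MemLp h 2 (cubeMeasure d)) :
    HasSum (fun mk => ‖cubeCoeff h mk‖ ^ 2) (∫ z, ‖h z‖ ^ 2 ∂cubeMeasure d) := by
  set e := MeasurableEquiv.sumPiEquivProdPi (fun _ : Fin d ⊕ Fin d => ℝ) with he
  have hmp : MeasurePreserving e (volume.restrict (halfCube (Fin d ⊕ Fin d))) (cubeMeasure d) := by
    have h0 := (volume_measurePreserving_sumPiEquivProdPi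
      (fun _ : Fin d ⊕ Fin d => ℝ)).restrict_preimage_emb e.measurableEmbedding
        (halfCube (Fin d) ×ˢ halfCube (Fin d))
    have h1 : (volume.restrict (halfCube (Fin d) ×ˢ halfCube (Fin d))) = cubeMeasure d := by
      rw [cubeMeasure_eq, Measure.volume_eq_prod, ← Measure.prod_restrict,
        Measure.restrict_congr_set (halfCube_ae_eq d)]
    rw [h1] at h0
    convert! h0 using 2
    ext x
    simp [halfCube, MeasurableEquiv.sumPiEquivProdPi, Equiv.sumPiEquivProdPi]
  have h1 := hasSum_sq_fourier_halfCube (hh.comp_measurePreserving hmp)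
  have h2 := hmp.integral_comp e.measurableEmbedding (fun z => ‖h z‖ ^ 2)
  simp only [Function.comp] at h1
  rw [h2] at h1
  rw [← (Equiv.sumArrowEquivProdArrow (Fin d) (Fin d) ℤ).hasSum_iff]
  refine h1.congr_fun fun n => ?_
  simp only [Function.comp, cubeCoeff]
  rw [← hmp.integral_comp e.measurableEmbedding]
  congr 2
  refine integral_congr_ae (Filter.Eventually.of_forall fun x => ?_)
  simp only [expo_eq_prod, Fintype.prod_sum_type]
  rfl

/-! ### Weighted composition operators on `L²` -/

section WeightedComposition

variable {α β : Type*} [MeasurableSpace α] [MeasurableSpace β] {μ : Measure α} {ν : Measure β}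

theorem norm_sq_eq_integral (f : Lp ℂ 2 μ) : ‖f‖ ^ 2 = ∫ x, ‖f x‖ ^ 2 ∂μ := by
  have h1 := congrArg RCLike.re (L2.inner_def (𝕜 := ℂ) f f)
  rw [← norm_sq_eq_re_inner (𝕜 := ℂ)] at h1
  rw [h1, ← integral_re (L2.integrable_inner _ _)]
  refine integral_congr_ae (Filter.Eventually.of_forall fun x => ?_)
  exact (norm_sq_eq_re_inner (𝕜 := ℂ) (f x)).symm

variable {w : α → ℂ} {τ : α → β}

/-- Domination `μ.map τ ≤ ν` is assumed rather than equality because `z ↦ z.1 - c` carries the cube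
measure only onto a piece of Lebesgue measure on `ℝ^d`. -/
theorem ae_comp_of_map_le (hτ : Measurable τ) (hle : μ.map τ ≤ ν) {P : β → Prop}
    (h : ∀ᵐ y ∂ν, P y) : ∀ᵐ x ∂μ, P (τ x) :=
  ae_of_ae_map hτ.aemeasurable (hle.absolutelyContinuous.ae_le h)

theorem memLp_wcomp (hw : Measurable w) (hw1 : ∀ x, ‖w x‖ ≤ 1) (hτ : Measurable τ)
    (hle : μ.map τ ≤ ν) (f : Lp ℂ 2 ν) : MemLp (fun x => w x * f (τ x)) 2 μ := by
  have h : MemLp (f ∘ τ) 2 μ := ((Lp.memLp f).mono_measure hle).comp_of_map hτ.aemeasurable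
  refine h.of_le (hw.aestronglyMeasurable.mul h.1) (Filter.Eventually.of_forall fun x => ?_)
  simp only [norm_mul, Function.comp]
  exact mul_le_of_le_one_left (norm_nonneg _) (hw1 x)

/-- The weighted composition operator `f ↦ w · (f ∘ τ)` from `L²(ν)` to `L²(μ)`. -/
noncomputable def wcomp (hw : Measurable w) (hw1 : ∀ x, ‖w x‖ ≤ 1) (hτ : Measurable τ)
    (hle : μ.map τ ≤ ν) : Lp ℂ 2 ν →L[ℂ] Lp ℂ 2 μ :=
  LinearMap.mkContinuous
    { toFun := fun f => (memLp_wcomp hw hw1 hτ hle f).toLp _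
      map_add' := fun f g => by
        rw [← MemLp.toLp_add, MemLp.toLp_eq_toLp_iff]
        filter_upwards [ae_comp_of_map_le hτ hle (Lp.coeFn_add f g)] with x hx
        simp only [Pi.add_apply] at hx ⊢
        rw [hx, mul_add]
      map_smul' := fun c f => by
        rw [RingHom.id_apply, ← MemLp.toLp_const_smul, MemLp.toLp_eq_toLp_iff]
        filter_upwards [ae_comp_of_map_le hτ hle (Lp.coeFn_smul c f)] with x hx
        simp only [Pi.smul_apply, smul_eq_mul] at hx ⊢
        rw [hx]
        ring } 1 fun f => by
    rw [one_mul, LinearMap.coe_mk, AddHom.coe_mk, Lp.norm_toLp, Lp.norm_def]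
    refine ENNReal.toReal_mono (Lp.eLpNorm_ne_top f) ?_
    calc eLpNorm (fun x => w x * f (τ x)) 2 μ ≤ eLpNorm (f ∘ τ) 2 μ := by
          refine eLpNorm_mono fun x => ?_
          simp only [norm_mul, Function.comp]
          exact mul_le_of_le_one_left (norm_nonneg _) (hw1 x)
      _ = eLpNorm f 2 (μ.map τ) :=
          (eLpNorm_map_measure ((Lp.memLp f).mono_measure hle).1 hτ.aemeasurable).symm
      _ ≤ eLpNorm f 2 ν := eLpNorm_mono_measure _ hle

theorem coeFn_wcomp (hw : Measurable w) (hw1 : ∀ x, ‖w x‖ ≤ 1) (hτ : Measurable τ)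
    (hle : μ.map τ ≤ ν) (f : Lp ℂ 2 ν) :
    wcomp hw hw1 hτ hle f =ᵐ[μ] fun x => w x * f (τ x) :=
  (memLp_wcomp hw hw1 hτ hle f).coeFn_toLp

end WeightedComposition

/-! ### Unitarity of the Zak transform -/

variable {d : ℕ}

instance isProbabilityMeasure_restrict_cube :
    IsProbabilityMeasure ((volume : Measure (Fin d → ℝ)).restrict (cube d)) :=
  ⟨by simp [cube, Real.volume_Icc_pi]⟩

instance isProbabilityMeasure_cubeMeasure : IsProbabilityMeasure (cubeMeasure d) := by
  rw [cubeMeasure_eq]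
  infer_instance

theorem map_fst_sub_cubeMeasure_le (c : Fin d → ℝ) :
    (cubeMeasure d).map (fun z => z.1 - c) ≤ volume := by
  have h1 : (cubeMeasure d).map (fun z => z.1 - c) =
      ((volume : Measure (Fin d → ℝ)).restrict (cube d)).map (fun x => x - c) := by
    rw [cubeMeasure_eq]
    have := Measure.map_map (μ := ((volume : Measure (Fin d → ℝ)).restrict (cube d)).prod
      (volume.restrict (cube d))) (measurable_sub_const c) (measurable_fst)
    rw [measurePreserving_fst.map_eq] at this
    exact this.symm
  rw [h1]
  exact (Measure.map_mono Measure.restrict_le_self (measurable_sub_const c)).trans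
    (measurePreserving_sub_right volume c).map_eq.le

theorem measurable_expo (u : Fin d → ℝ) : Measurable (expo u) := (continuous_expo u).measurable

theorem measurable_expo_snd (u : Fin d → ℝ) :
    Measurable fun z : (Fin d → ℝ) × (Fin d → ℝ) => expo u z.2 :=
  (measurable_expo u).comp measurable_snd

theorem measurable_expo_fst (u : Fin d → ℝ) :
    Measurable fun z : (Fin d → ℝ) × (Fin d → ℝ) => expo u z.1 :=
  (measurable_expo u).comp measurable_fst

/-- `zakTerm` as a continuous linear map. -/
noncomputable def zakTermL (k : Fin d → ℤ) :
    Lp ℂ 2 (volume : Measure (Fin d → ℝ)) →L[ℂ] Lp ℂ 2 (cubeMeasure d) :=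
  wcomp (w := fun z => expo (ofInt k) z.2) (τ := fun z => z.1 - ofInt k)
    (measurable_expo_snd _) (fun _ => (norm_expo _ _).le)
    (measurable_fst.sub_const _) (map_fst_sub_cubeMeasure_le _)

theorem zakTermL_apply (k : Fin d → ℤ) (f : Lp ℂ 2 (volume : Measure (Fin d → ℝ))) :
    zakTermL k f = zakTerm f k := by
  refine Lp.ext ?_
  filter_upwards [coeFn_wcomp (w := fun z => expo (ofInt k) z.2) (τ := fun z => z.1 - ofInt k)
    (measurable_expo_snd _) (fun _ => (norm_expo _ _).le)
    (measurable_fst.sub_const _) (map_fst_sub_cubeMeasure_le _) f,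
    (memLp_zakTermFun f k).coeFn_toLp] with z h1 h2
  rw [zakTermL, h1, zakTerm, h2, zakTermFun, mul_comm]

/-- The `k`-th term carries the mass of `f` on the cube translated by `-k`, and these half-open
translates tile `ℝ^d`. -/
theorem hasSum_norm_zakTerm_sq (f : Lp ℂ 2 (volume : Measure (Fin d → ℝ))) :
    HasSum (fun k : Fin d → ℤ => ‖zakTerm f k‖ ^ 2) (‖f‖ ^ 2) := by
  set s : (Fin d → ℤ) → Set (Fin d → ℝ) :=
    fun k => {y | y + ofInt k ∈ Set.pi Set.univ fun _ => Set.Ico (0 : ℝ) 1} with hs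
  have hcube : (Set.pi Set.univ fun _ => Set.Ico (0 : ℝ) 1) =ᵐ[volume] cube d :=
    Measure.univ_pi_Ico_ae_eq_Icc
  have hmeas : MeasurableSet (Set.pi Set.univ fun _ : Fin d => Set.Ico (0 : ℝ) 1) :=
    MeasurableSet.univ_pi fun _ => measurableSet_Ico
  have hsm : ∀ k, MeasurableSet (s k) := fun k => (measurable_add_const (ofInt k)) hmeas
  have hmem : ∀ k y, y ∈ s k ↔ k = fun i => -⌊y i⌋ := by
    intro k y
    simp only [hs, Set.mem_ofPred_eq, Set.mem_pi, Set.mem_univ, true_implies, Pi.add_apply, ofInt,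
      funext_iff]
    refine forall_congr' fun i => ?_
    rw [← neg_eq_iff_eq_neg, eq_comm, Int.floor_eq_iff, Set.mem_Ico]
    push_cast
    constructor <;> rintro ⟨h1, h2⟩ <;> constructor <;> linarith
  have hd : Pairwise (Function.onFun Disjoint s) := by
    intro k l hkl
    refine Set.disjoint_left.2 fun y hk hl => hkl ?_
    rw [(hmem k y).1 hk, (hmem l y).1 hl]
  have hU : ⋃ k, s k = Set.univ :=
    Set.eq_univ_of_forall fun y => Set.mem_iUnion.2 ⟨_, (hmem _ y).2 rfl⟩
  have hint : Integrable (fun x => ‖f x‖ ^ 2) volume :=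
    (memLp_two_iff_integrable_sq_norm (Lp.memLp f).1).1 (Lp.memLp f)
  have hsum := hasSum_integral_iUnion hsm hd hint.integrableOn
  rw [hU, Measure.restrict_univ, ← norm_sq_eq_integral] at hsum
  refine hsum.congr_fun fun k => ?_
  have h := (measurePreserving_add_right volume (ofInt k)).setIntegral_preimage_emb
    (measurableEmbedding_addRight (ofInt k)) (fun x => ‖f (x - ofInt k)‖ ^ 2)
    (Set.pi Set.univ fun _ => Set.Ico (0 : ℝ) 1)
  rw [norm_zakTerm_sq, ← setIntegral_congr_set hcube, ← h]
  simp only [add_sub_cancel_right]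
  rfl

/-- Pythagoras for the pairwise orthogonal terms of the Zak series. -/
theorem norm_zakCube (f : Lp ℂ 2 (volume : Measure (Fin d → ℝ))) : ‖zakCube f‖ = ‖f‖ := by
  have hS : HasSum (fun k => zakTerm f k) (zakCube f) := (summable_zakTerm f).hasSum
  have h1 : ∀ k, inner ℂ (zakTerm f k) (zakCube f) = ((‖zakTerm f k‖ ^ 2 : ℝ) : ℂ) := by
    intro k
    have h := hS.mapL (innerSL ℂ (zakTerm f k))
    have h' := hasSum_single (f := fun l => innerSL ℂ (zakTerm f k) (zakTerm f l)) k
      (fun l hl => by simpa using inner_zakTerm f k l hl.symm)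
    rw [← innerSL_apply_apply, h.unique h', innerSL_apply_apply, inner_self_eq_norm_sq_to_K]
    push_cast
    rfl
  have h2 := hS.mapL (innerSL ℂ (zakCube f))
  have h3 : HasSum (fun k => ‖zakTerm f k‖ ^ 2) (‖zakCube f‖ ^ 2) := by
    have h4 := Complex.hasSum_re h2
    have h5 : (innerSL ℂ (zakCube f) (zakCube f)).re = ‖zakCube f‖ ^ 2 := by
      rw [innerSL_apply_apply]
      exact (norm_sq_eq_re_inner (𝕜 := ℂ) _).symm
    rw [h5] at h4
    refine h4.congr_fun fun k => ?_
    rw [innerSL_apply_apply, ← inner_conj_symm, h1, Complex.conj_ofReal, Complex.ofReal_re]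
  have h := h3.unique (hasSum_norm_zakTerm_sq f)
  exact (sq_eq_sq₀ (norm_nonneg _) (norm_nonneg _)).1 h

/-- The Zak transform as a linear isometry. -/
noncomputable def zakIsometry :
    Lp ℂ 2 (volume : Measure (Fin d → ℝ)) →ₗᵢ[ℂ] Lp ℂ 2 (cubeMeasure d) where
  toFun := zakCube
  map_add' f g := by
    unfold zakCube
    rw [← (summable_zakTerm f).tsum_add (summable_zakTerm g)]
    simp only [← zakTermL_apply, map_add]
  map_smul' c f := by
    unfold zakCube
    rw [RingHom.id_apply, ← (summable_zakTerm f).tsum_const_smul]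
    simp only [← zakTermL_apply, map_smul]
  norm_map' := norm_zakCube

theorem inner_zakCube (f g : Lp ℂ 2 (volume : Measure (Fin d → ℝ))) :
    inner ℂ (zakCube f) (zakCube g) = inner ℂ f g :=
  zakIsometry.inner_map_map f g

theorem expo_ofInt_sub (k n : Fin d → ℤ) (t : Fin d → ℝ) :
    expo (ofInt k) (t - ofInt n) = expo (ofInt k) t := by
  rw [← expo_ofInt_add k n, sub_add_cancel]

/-- Take the character `expo (ofInt m)` cut off to the unit cube translated by `-k`: only the `k`-th
term of its Zak series survives. -/
theorem exists_zakCube_eq_expo (m k : Fin d → ℤ) :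
    ∃ f : Lp ℂ 2 (volume : Measure (Fin d → ℝ)), zakCube f =ᵐ[cubeMeasure d]
      fun z => expo (ofInt m) z.1 * expo (ofInt k) z.2 := by
  set Q : Set (Fin d → ℝ) := Set.pi Set.univ fun _ => Set.Ico (0 : ℝ) 1 with hQ
  have hcube : Q =ᵐ[volume] cube d := Measure.univ_pi_Ico_ae_eq_Icc
  have hmeas : MeasurableSet Q := MeasurableSet.univ_pi fun _ => measurableSet_Ico
  set S : Set (Fin d → ℝ) := (fun y => y + ofInt k) ⁻¹' Q with hS
  have hSm : MeasurableSet S := measurable_add_const (ofInt k) hmeas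
  have hSv : volume S ≠ ∞ := by
    rw [hS, measure_preimage_add_right, measure_congr hcube]
    exact isCompact_Icc.measure_lt_top.ne
  have hmem : MemLp (S.indicator (expo (ofInt m))) 2 volume := by
    refine (memLp_indicator_const 2 hSm (1 : ℂ) (Or.inr hSv)).of_le
      ((measurable_expo _).indicator hSm).aestronglyMeasurable
      (Filter.Eventually.of_forall fun y => ?_)
    by_cases hy : y ∈ S <;> simp [hy, norm_expo]
  set f := hmem.toLp _ with hf
  have hz : ∀ᵐ z ∂cubeMeasure d, z.1 ∈ Q := by
    rw [cubeMeasure_eq, ← Measure.restrict_congr_set hcube]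
    exact Measure.quasiMeasurePreserving_fst.ae (ae_restrict_mem hmeas)
  have hterm : ∀ l, zakTerm f l =ᵐ[cubeMeasure d] fun z =>
      S.indicator (expo (ofInt m)) (z.1 - ofInt l) * expo (ofInt l) z.2 := by
    intro l
    filter_upwards [(memLp_zakTermFun f l).coeFn_toLp, ae_comp_of_map_le
      (measurable_fst.sub_const _) (map_fst_sub_cubeMeasure_le (ofInt l)) hmem.coeFn_toLp]
      with z h1 h2
    rw [zakTerm, h1, zakTermFun, h2]
  have hne : ∀ l, l ≠ k → zakTerm f l = 0 := by
    intro l hl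
    refine Lp.ext ?_
    filter_upwards [hterm l, hz, Lp.coeFn_zero ℂ 2 (cubeMeasure d)] with z h1 h2 h3
    rw [h1, h3, Set.indicator_of_notMem, zero_mul, Pi.zero_apply]
    intro h
    refine hl (funext fun i => ?_)
    have h4 := h i (Set.mem_univ i)
    have h5 := h2 i (Set.mem_univ i)
    simp only [Pi.add_apply, Pi.sub_apply, ofInt, Set.mem_Ico] at h4 h5
    have h6 : ((l i : ℤ) : ℝ) < k i + 1 := by linarith
    have h7 : ((k i : ℤ) : ℝ) < l i + 1 := by linarith
    have h6' : l i < k i + 1 := by exact_mod_cast h6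
    have h7' : k i < l i + 1 := by exact_mod_cast h7
    omega
  refine ⟨f, ?_⟩
  rw [zakCube, tsum_eq_single k hne]
  filter_upwards [hterm k, hz] with z h1 h2
  rw [h1, Set.indicator_of_mem, expo_ofInt_sub]
  simpa [hS] using h2

/-- The range is closed, being an isometric image of a complete space, and contains every character.
A vector orthogonal to it has no nonzero Fourier coefficient, so it vanishes by Parseval. -/
theorem zakCube_surjective :
    Function.Surjective (zakCube : Lp ℂ 2 (volume : Measure (Fin d → ℝ)) → _) := by
  set T := (zakIsometry (d := d)) with hT
  set R : Submodule ℂ (Lp ℂ 2 (cubeMeasure d)) := LinearMap.range T.toLinearMap with hR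
  have hcl : IsClosed (R : Set (Lp ℂ 2 (cubeMeasure d))) :=
    T.isometry.isClosedEmbedding.isClosed_range
  have : CompleteSpace R := hcl.completeSpace_coe
  have htop : R = ⊤ := by
    rw [← Submodule.orthogonal_eq_bot_iff, Submodule.eq_bot_iff]
    intro Φ hΦ
    have h0 : ∀ mk, cubeCoeff Φ mk = 0 := by
      intro mk
      obtain ⟨f, hf⟩ := exists_zakCube_eq_expo mk.1 mk.2
      have h1 : inner ℂ (zakCube f) Φ = 0 := hΦ _ ⟨f, rfl⟩
      rw [← h1, L2.inner_def, cubeCoeff]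
      refine integral_congr_ae ?_
      filter_upwards [hf] with z hz
      rw [hz, RCLike.inner_apply, mul_comm]
    have h1 := hasSum_sq_cubeCoeff (Lp.memLp Φ)
    simp only [h0, norm_zero, ne_eq, OfNat.ofNat_ne_zero, not_false_eq_true, zero_pow] at h1
    rw [← norm_sq_eq_integral] at h1
    simpa using h1.unique hasSum_zero
  intro Φ
  have : Φ ∈ R := htop ▸ Submodule.mem_top
  exact this

/-! ### The Zak transform of time-frequency shifts -/

/-- `Int.fract` factors through the circle, so it pushes every interval `(t, t + 1]` to the same
measure; `t = 0` identifies that measure and `t = -c` gives the claim. -/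
theorem measurePreserving_fract_sub (c : ℝ) :
    MeasurePreserving (fun x : ℝ => Int.fract (x - c)) (volume.restrict (Set.Icc 0 1))
      (volume.restrict (Set.Icc 0 1)) := by
  set F : UnitAddCircle → ℝ := fun θ => (AddCircle.measurableEquivIco (1 : ℝ) 0 θ).1 with hF
  have hFm : Measurable F :=
    measurable_subtype_coe.comp (AddCircle.measurableEquivIco (1 : ℝ) 0).measurable
  have hFmk : ∀ x : ℝ, F (x : UnitAddCircle) = Int.fract x := by
    intro x
    have := AddCircle.coe_equivIco_mk_apply (1 : ℝ) x
    rw [div_one, mul_one] at this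
    exact this
  have key : ∀ t : ℝ, MeasurePreserving (Int.fract : ℝ → ℝ) (volume.restrict (Set.Ioc t (t + 1)))
      (Measure.map F volume) := by
    intro t
    refine ⟨measurable_fract, ?_⟩
    rw [← (UnitAddCircle.measurePreserving_mk t).map_eq,
      Measure.map_map hFm AddCircle.measurable_mk']
    congr 1
    funext x
    exact (hFmk x).symm
  have h0 : Measure.map F volume = volume.restrict (Set.Icc (0 : ℝ) 1) := by
    rw [← (key 0).map_eq, zero_add, Measure.restrict_congr_set
      (Ioc_ae_eq_Icc.trans Ico_ae_eq_Icc.symm : Set.Ioc (0 : ℝ) 1 =ᵐ[volume] Set.Ico 0 1),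
      Measure.restrict_congr_set (Ico_ae_eq_Icc.symm : Set.Icc (0 : ℝ) 1 =ᵐ[volume] Set.Ico 0 1)]
    conv_rhs => rw [← Measure.map_id (μ := volume.restrict (Set.Ico (0 : ℝ) 1))]
    refine Measure.map_congr ?_
    filter_upwards [ae_restrict_mem measurableSet_Ico] with x hx
    exact Int.fract_eq_self.2 hx
  rw [h0] at key
  have h1 := (measurePreserving_sub_right (volume : Measure ℝ) c).restrict_preimage
    (measurableSet_Ioc (a := -c) (b := -c + 1))
  have h2 := (key (-c)).comp h1
  have h3 : (fun x : ℝ => x - c) ⁻¹' Set.Ioc (-c) (-c + 1) = Set.Ioc 0 1 := by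
    ext x
    simp only [Set.mem_preimage, Set.mem_Ioc]
    constructor <;> rintro ⟨h1, h2⟩ <;> constructor <;> linarith
  rw [h3, Measure.restrict_congr_set (Ioc_ae_eq_Icc : Set.Ioc (0 : ℝ) 1 =ᵐ[volume] _)] at h2
  exact h2


theorem restrict_cube_eq_pi : (volume : Measure (Fin d → ℝ)).restrict (cube d) =
    Measure.pi fun _ => (volume : Measure ℝ).restrict (Set.Icc 0 1) := by
  rw [← Measure.restrict_pi_pi, Set.pi_univ_Icc]
  rfl

theorem measurePreserving_fract_sub_cube (c : Fin d → ℝ) :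
    MeasurePreserving (fun x : Fin d → ℝ => fun i => Int.fract (x i - c i))
      (volume.restrict (cube d)) (volume.restrict (cube d)) := by
  rw [restrict_cube_eq_pi]
  exact measurePreserving_pi _ _ fun i => measurePreserving_fract_sub (c i)

/-- Reduction modulo `ℤ^{2d}` of the shift by `-c` in the first variable. -/
noncomputable def fractShift (c : Fin d → ℝ) (z : (Fin d → ℝ) × (Fin d → ℝ)) :
    (Fin d → ℝ) × (Fin d → ℝ) :=
  (fun i => Int.fract (z.1 i - c i), fun i => Int.fract (z.2 i))

theorem measurePreserving_fractShift (c : Fin d → ℝ) :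
    MeasurePreserving (fractShift c) (cubeMeasure d) (cubeMeasure d) := by
  rw [cubeMeasure_eq]
  have h := (measurePreserving_fract_sub_cube c).prod (measurePreserving_fract_sub_cube (0 : Fin d → ℝ))
  convert! h using 1
  funext z
  simp [fractShift, Prod.map]

theorem expo_ofInt_fract (k : Fin d → ℤ) (t : Fin d → ℝ) :
    expo (ofInt k) (fun i => Int.fract (t i)) = expo (ofInt k) t := by
  rw [← expo_ofInt_sub k (fun i => ⌊t i⌋) t]
  congr 1

/-- The Zak series converges only in `L²`, so it cannot be reindexed pointwise. Where the integer
part of `x - c` is a fixed `v`, the `k`-th term for `g` at the reduced point matches the `(v +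
k)`-th term for `f`. The bounded operators `L v` and `R v` localise to that set and pass through the
sums; countably many `v` cover everything. -/
theorem zakCube_modulate_translate (m : Fin d → ℤ) (c : Fin d → ℝ)
    {f g : Lp ℂ 2 (volume : Measure (Fin d → ℝ))}
    (hf : f =ᵐ[volume] fun y => expo (ofInt m) y * g (y - c)) :
    zakCube f =ᵐ[cubeMeasure d] fun z => expo (ofInt m) z.1 * zak g (z.1 - c) z.2 := by
  set E : (Fin d → ℤ) → Set ((Fin d → ℝ) × (Fin d → ℝ)) :=
    fun v => {z | (fun i => ⌊z.1 i - c i⌋) = v} with hE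
  have hEm : ∀ v, MeasurableSet (E v) := fun v => by
    have : Measurable fun z : (Fin d → ℝ) × (Fin d → ℝ) => fun i => ⌊z.1 i - c i⌋ :=
      measurable_pi_lambda _ fun i =>
        Int.measurable_floor.comp (((measurable_pi_apply i).comp measurable_fst).sub_const _)
    exact this (measurableSet_singleton v)
  set w₁ : (Fin d → ℤ) → (Fin d → ℝ) × (Fin d → ℝ) → ℂ := fun v =>
    (E v).indicator fun z => expo (ofInt v) z.2 * expo (ofInt m) z.1 with hw₁
  have hw₁m : ∀ v, Measurable (w₁ v) := fun v =>
    ((measurable_expo_snd _).mul (measurable_expo_fst _)).indicator (hEm v)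
  have hw₁n : ∀ v z, ‖w₁ v z‖ ≤ 1 := fun v z => by
    by_cases hz : z ∈ E v <;> simp [hw₁, hz, norm_expo]
  set w₂ : (Fin d → ℤ) → (Fin d → ℝ) × (Fin d → ℝ) → ℂ := fun v =>
    (E v).indicator fun _ => 1 with hw₂
  have hw₂m : ∀ v, Measurable (w₂ v) := fun v => measurable_const.indicator (hEm v)
  have hw₂n : ∀ v z, ‖w₂ v z‖ ≤ 1 := fun v z => by
    by_cases hz : z ∈ E v <;> simp [hw₂, hz]
  have hτ := measurePreserving_fractShift c
  set L := fun v => wcomp (hw₁m v) (hw₁n v) hτ.measurable hτ.map_eq.le with hL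
  set R := fun v => wcomp (μ := cubeMeasure d) (hw₂m v) (hw₂n v) measurable_id
    Measure.map_id.le with hR
  have hterm : ∀ v k, L v (zakTerm g k) = R v (zakTerm f (v + k)) := by
    intro v k
    refine Lp.ext ?_
    filter_upwards [coeFn_wcomp (hw₁m v) (hw₁n v) hτ.measurable hτ.map_eq.le (zakTerm g k),
      coeFn_wcomp (μ := cubeMeasure d) (hw₂m v) (hw₂n v) measurable_id
        Measure.map_id.le (zakTerm f (v + k)),
      ae_comp_of_map_le hτ.measurable hτ.map_eq.le (memLp_zakTermFun g k).coeFn_toLp,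
      (memLp_zakTermFun f (v + k)).coeFn_toLp,
      ae_comp_of_map_le (measurable_fst.sub_const _) (map_fst_sub_cubeMeasure_le (ofInt (v + k)))
        hf] with z h1 h2 h3 h4 h5
    simp only [hL, hR]
    rw [h1, h2, id, zakTerm, h3, zakTerm, h4, zakTermFun, zakTermFun, h5]
    by_cases hz : z ∈ E v
    · have hv : ∀ i, ⌊z.1 i - c i⌋ = v i := fun i => congrFun hz i
      have h6 : (fractShift c z).1 - ofInt k = z.1 - ofInt (v + k) - c := by
        funext i
        simp only [fractShift, Pi.sub_apply, Int.fract, hv, ofInt, Pi.add_apply]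
        push_cast
        ring
      have h7 : ofInt (v + k) = ofInt v + ofInt k := by
        funext i
        simp [ofInt]
      simp only [hw₁, hw₂, Set.indicator_of_mem hz]
      rw [h6, expo_ofInt_sub, one_mul]
      simp only [fractShift, expo_ofInt_fract]
      rw [h7, expo_add_left]
      ring
    · simp [hw₁, hw₂, hz]
  have hsum : ∀ v, L v (zakCube g) = R v (zakCube f) := by
    intro v
    have h1 := (summable_zakTerm g).hasSum.mapL (L v)
    have h2 := ((Equiv.addLeft v).hasSum_iff.2 (summable_zakTerm f).hasSum).mapL (R v)
    refine h1.unique (h2.congr_fun fun k => ?_)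
    exact hterm v k
  have hae : ∀ᵐ z ∂cubeMeasure d, ∀ v, w₁ v z * zakCube g (fractShift c z) =
      w₂ v z * zakCube f z := by
    refine ae_all_iff.2 fun v => ?_
    filter_upwards [coeFn_wcomp (hw₁m v) (hw₁n v) hτ.measurable hτ.map_eq.le (zakCube g),
      coeFn_wcomp (μ := cubeMeasure d) (hw₂m v) (hw₂n v) measurable_id
        Measure.map_id.le (zakCube f)] with z h1 h2
    rw [← h1]
    exact (congrArg (fun F : Lp ℂ 2 (cubeMeasure d) => F z) (hsum v)).trans h2
  filter_upwards [hae] with z hz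
  have h := hz fun i => ⌊z.1 i - c i⌋
  have hz : z ∈ E fun i => ⌊z.1 i - c i⌋ := rfl
  simp only [hw₁, hw₂, Set.indicator_of_mem hz, one_mul] at h
  rw [← h, zak]
  simp only [fractShift, Pi.sub_apply]
  ring

theorem zakCube_gaborSystem (g : Lp ℂ 2 (volume : Measure (Fin d → ℝ))) (a : ℝ)
    (m n : Fin d → ℤ) : zakCube (gaborSystem g a 1 (m, n)) =ᵐ[cubeMeasure d]
      fun z => expo (ofInt m) z.1 * zak g (z.1 - a • ofInt n) z.2 := by
  refine zakCube_modulate_translate m (a • ofInt n) ?_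
  filter_upwards [(memLp_gaborFun g a 1 m n).coeFn_toLp] with y hy
  rw [gaborSystem, hy, gaborFun, one_smul]

/-! ### Parseval's identity on boxes of side `1/p` -/

/-- The box `∏ᵢ [sᵢ/p, (sᵢ+1)/p]`. -/
def box (p : ℕ) (s : Fin d → Fin p) : Set (Fin d → ℝ) :=
  {t | ∀ i, (p : ℝ) * t i - ((s i : ℕ) : ℝ) ∈ Set.Icc (0 : ℝ) 1}

theorem measurableSet_box (p : ℕ) (s : Fin d → Fin p) : MeasurableSet (box p s) :=
  MeasurableSet.univ_pi' fun i =>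
    (((measurable_id.const_mul (p : ℝ)).sub_const ((s i : ℕ) : ℝ)) measurableSet_Icc :
      MeasurableSet {y : ℝ | (p : ℝ) * y - ((s i : ℕ) : ℝ) ∈ Set.Icc (0 : ℝ) 1})

theorem box_subset_cube {p : ℕ} (hp : 0 < p) (s : Fin d → Fin p) : box p s ⊆ cube d := by
  have hp' : (0 : ℝ) < p := by exact_mod_cast hp
  intro t ht
  refine ⟨fun i => ?_, fun i => ?_⟩
  · have h := (ht i).1
    have h0 : (0 : ℝ) ≤ ((s i : ℕ) : ℝ) := Nat.cast_nonneg _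
    exact nonneg_of_mul_nonneg_right (by linarith) hp'
  · have h := (ht i).2
    have h0 : ((s i : ℕ) : ℝ) + 1 ≤ p := by exact_mod_cast (s i).2
    have h1 : (p : ℝ) * t i ≤ p * 1 := by linarith
    exact le_of_mul_le_mul_left h1 hp'

theorem exists_mem_box {p : ℕ} (hp : 0 < p) {t : Fin d → ℝ} (ht : t ∈ cube d) :
    ∃ s, t ∈ box p s := by
  have hp' : (0 : ℝ) < p := by exact_mod_cast hp
  have h : ∀ i, ∃ k : Fin p, (p : ℝ) * t i - ((k : ℕ) : ℝ) ∈ Set.Icc (0 : ℝ) 1 := by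
    intro i
    have h0 : 0 ≤ t i := ht.1 i
    have h1 : t i ≤ 1 := ht.2 i
    rcases h1.lt_or_eq with h1 | h1
    · have h2 : 0 ≤ (p : ℝ) * t i := by positivity
      refine ⟨⟨⌊(p : ℝ) * t i⌋₊, ?_⟩, ?_, ?_⟩
      · rw [Nat.floor_lt h2]
        nlinarith
      · simpa using Nat.floor_le h2
      · have := (Nat.lt_floor_add_one ((p : ℝ) * t i)).le
        simp only
        linarith
    · refine ⟨⟨p - 1, by omega⟩, ?_⟩
      rw [h1]
      simp [Nat.cast_sub hp]
  choose s hs using h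
  exact ⟨s, hs⟩

/-- The affine homeomorphism `(x, u) ↦ (x, (u + s) / p)`. -/
noncomputable def boxScale {p : ℕ} (hp : 0 < p) (s : Fin d → Fin p) :
    (Fin d → ℝ) × (Fin d → ℝ) ≃ₜ (Fin d → ℝ) × (Fin d → ℝ) :=
  (Homeomorph.refl _).prodCongr ((Homeomorph.addRight (fun i => ((s i : ℕ) : ℝ))).trans
    (Homeomorph.smulOfNeZero ((p : ℝ)⁻¹) (by positivity)))

theorem boxScale_apply {p : ℕ} (hp : 0 < p) (s : Fin d → Fin p) (z) :
    boxScale hp s z = (z.1, (p : ℝ)⁻¹ • (z.2 + fun i => ((s i : ℕ) : ℝ))) := rfl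

theorem map_boxScale {p : ℕ} (hp : 0 < p) (s : Fin d → Fin p) :
    (cubeMeasure d).map (boxScale hp s) =
      ENNReal.ofReal ((p : ℝ) ^ d) • (cubeMeasure d).restrict (Set.univ ×ˢ box p s) := by
  have hp' : (0 : ℝ) < p := by exact_mod_cast hp
  set σ : (Fin d → ℝ) ≃ₜ (Fin d → ℝ) := (Homeomorph.addRight (fun i => ((s i : ℕ) : ℝ))).trans
    (Homeomorph.smulOfNeZero ((p : ℝ)⁻¹) (by positivity)) with hσ
  have h1 : (volume : Measure (Fin d → ℝ)).map σ = ENNReal.ofReal ((p : ℝ) ^ d) • volume := by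
    have h := Measure.map_map (μ := (volume : Measure (Fin d → ℝ)))
      (measurable_const_smul ((p : ℝ)⁻¹)) (measurable_add_const fun i => ((s i : ℕ) : ℝ))
    rw [(measurePreserving_add_right volume _).map_eq] at h
    refine h.symm.trans ((Measure.map_addHaar_smul volume (by positivity)).trans ?_)
    simp
  have h2 : σ ⁻¹' box p s = cube d := by
    ext u
    simp only [Set.mem_preimage, box, Set.mem_ofPred_eq, cube, Set.mem_Icc, Pi.le_def,
      ← forall_and]
    refine forall_congr' fun i => ?_
    have : (p : ℝ) * σ u i - ((s i : ℕ) : ℝ) = u i := by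
      simp [hσ]
      field_simp
      ring
    rw [this]
    rfl
  have h3 : ((volume : Measure (Fin d → ℝ)).restrict (cube d)).map σ =
      ENNReal.ofReal ((p : ℝ) ^ d) • (volume.restrict (cube d)).restrict (box p s) := by
    rw [← h2, ← σ.measurableEmbedding.restrict_map, h1, Measure.restrict_smul, h2,
      Measure.restrict_restrict_of_subset (box_subset_cube hp s)]
  rw [cubeMeasure_eq, ← Measure.prod_restrict, ← Measure.prod_smul_right, Measure.restrict_univ,
    ← h3]
  have h4 := Measure.map_prod_map ((volume : Measure (Fin d → ℝ)).restrict (cube d))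
    ((volume : Measure (Fin d → ℝ)).restrict (cube d)) measurable_id σ.measurable
  rw [Measure.map_id] at h4
  exact h4.symm

theorem integral_boxScale {E : Type*} [NormedAddCommGroup E] [NormedSpace ℝ E] {p : ℕ} (hp : 0 < p)
    (s : Fin d → Fin p) (φ : (Fin d → ℝ) × (Fin d → ℝ) → E)
    (hφ : ∀ z, z.2 ∉ box p s → φ z = 0) :
    ∫ z, φ (boxScale hp s z) ∂cubeMeasure d = (p : ℝ) ^ d • ∫ z, φ z ∂cubeMeasure d := by
  rw [← (boxScale hp s).measurableEmbedding.integral_map, map_boxScale, integral_smul_measure,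
    ENNReal.toReal_ofReal (by positivity), setIntegral_eq_integral_of_forall_compl_eq_zero]
  intro z hz
  exact hφ z fun h => hz ⟨trivial, h⟩

/-- Stretching the box to the full cube turns frequency `p l` into `l`. Squared coefficients scale
by `p^{2d}` and the squared norm by `p^d`, which leaves the factor `p^{-d}`. -/
theorem hasSum_sq_cubeCoeff_of_box {p : ℕ} (hp : 0 < p) (s : Fin d → Fin p)
    {h : (Fin d → ℝ) × (Fin d → ℝ) → ℂ} (hh : MemLp h 2 (cubeMeasure d))
    (h0 : ∀ z, z.2 ∉ box p s → h z = 0) :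
    HasSum (fun ml : (Fin d → ℤ) × (Fin d → ℤ) =>
      ‖cubeCoeff h (ml.1, fun i => (p : ℤ) * ml.2 i)‖ ^ 2)
      (((p : ℝ) ^ d)⁻¹ * ∫ z, ‖h z‖ ^ 2 ∂cubeMeasure d) := by
  have hp' : (0 : ℝ) < p := by exact_mod_cast hp
  have hmem : MemLp (h ∘ boxScale hp s) 2 (cubeMeasure d) := by
    refine MemLp.comp_of_map ?_ (boxScale hp s).continuous.measurable.aemeasurable
    rw [map_boxScale]
    exact (hh.mono_measure Measure.restrict_le_self).smul_measure ENNReal.ofReal_ne_top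
  have h1 := hasSum_sq_cubeCoeff hmem
  have h2 : ∫ z, ‖(h ∘ boxScale hp s) z‖ ^ 2 ∂cubeMeasure d =
      (p : ℝ) ^ d * ∫ z, ‖h z‖ ^ 2 ∂cubeMeasure d :=
    integral_boxScale hp s (fun z => ‖h z‖ ^ 2) fun z hz => by simp [h0 z hz]
  have h3 : ∀ ml, cubeCoeff (h ∘ boxScale hp s) ml =
      (p : ℝ) ^ d • cubeCoeff h (ml.1, fun i => (p : ℤ) * ml.2 i) := by
    intro ml
    unfold cubeCoeff
    rw [← integral_boxScale hp s _ fun z hz => by rw [h0 z hz, mul_zero]]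
    congr 1
    funext z
    -- The offset `s` is an integer vector, so it contributes no phase.
    have he : expo (ofInt fun i => (p : ℤ) * ml.2 i) (boxScale hp s z).2 =
        expo (ofInt ml.2) z.2 := by
      rw [← expo_ofInt_add ml.2 (fun i => ((s i : ℕ) : ℤ)) z.2]
      unfold expo
      congr 3
      refine Finset.sum_congr rfl fun i _ => ?_
      simp only [boxScale_apply, ofInt, Pi.smul_apply, Pi.add_apply, smul_eq_mul]
      push_cast
      field_simp
    simp only [Function.comp]
    rw [he]
    rfl
  rw [h2] at h1
  have h4 := h1.mul_left (((p : ℝ) ^ d)⁻¹ ^ 2)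
  have hpd : (p : ℝ) ^ d ≠ 0 := by positivity
  have h5 : ((p : ℝ) ^ d)⁻¹ ^ 2 * ((p : ℝ) ^ d * ∫ z, ‖h z‖ ^ 2 ∂cubeMeasure d) =
      ((p : ℝ) ^ d)⁻¹ * ∫ z, ‖h z‖ ^ 2 ∂cubeMeasure d := by
    field_simp
  rw [h5] at h4
  refine h4.congr_fun fun ml => ?_
  rw [h3, norm_smul, Real.norm_of_nonneg (by positivity), mul_pow, inv_pow,
    inv_mul_cancel_left₀ (pow_ne_zero 2 hpd)]

/-! ### Gabor coefficients as Fourier coefficients -/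

theorem inner_gaborSystem {p q : ℕ} (hq : 0 < q) {g f : Lp ℂ 2 (volume : Measure (Fin d → ℝ))}
    {F : (Fin d → ℝ) × (Fin d → ℝ) → ℂ} (hF : zakCube f =ᵐ[cubeMeasure d] F) (r : Fin d → Fin q)
    (m l : Fin d → ℤ) :
    inner ℂ (gaborSystem g ((p : ℝ) / q) 1 (m, fun i => (q : ℤ) * -l i + ((r i : ℕ) : ℤ))) f =
      cubeCoeff (fun z => (starRingEnd ℂ) (zakWindow g p q r z) * F z)
        (m, fun i => (p : ℤ) * l i) := by
  have hq' : (q : ℝ) ≠ 0 := by positivity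
  rw [← inner_zakCube, L2.inner_def, cubeCoeff]
  refine integral_congr_ae ?_
  filter_upwards [hF, zakCube_gaborSystem g ((p : ℝ) / q) m
    (fun i => (q : ℤ) * -l i + ((r i : ℕ) : ℤ))] with z h1 h2
  have h3 : z.1 - ((p : ℝ) / q) • ofInt (fun i => (q : ℤ) * -l i + ((r i : ℕ) : ℤ)) =
      (fun i => z.1 i - (p : ℝ) / (q : ℝ) * ((r i : ℕ) : ℝ)) + ofInt (fun i => (p : ℤ) * l i) := by
    funext i
    simp only [ofInt, Pi.sub_apply, Pi.smul_apply, Pi.add_apply, smul_eq_mul]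
    push_cast
    field_simp
    ring
  rw [h1, h2, h3, zak_add_left, RCLike.inner_apply]
  simp only [map_mul, zakWindow]
  ring

/-- Almost everywhere the window is the Zak transform of the unmodulated Gabor element with `n = r`.
-/
theorem memLp_zakWindow (g : Lp ℂ 2 (volume : Measure (Fin d → ℝ))) (p q : ℕ)
    (r : Fin d → Fin q) : MemLp (zakWindow g p q r) 2 (cubeMeasure d) := by
  refine (memLp_congr_ae ?_).1
    (Lp.memLp (zakCube (gaborSystem g ((p : ℝ) / q) 1 (0, fun i => ((r i : ℕ) : ℤ)))))
  filter_upwards [zakCube_gaborSystem g ((p : ℝ) / q) 0 (fun i => ((r i : ℕ) : ℤ))] with z hz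
  rw [hz]
  have h1 : expo (ofInt (0 : Fin d → ℤ)) z.1 = 1 := by simp [expo, ofInt]
  rw [h1, one_mul, zakWindow]
  rfl

/-- Division with remainder in each coordinate, `(r, m, l) ↦ (m, r - q l)`. -/
def gaborIndexEquiv (d q : ℕ) [NeZero q] :
    (Fin d → Fin q) × ((Fin d → ℤ) × (Fin d → ℤ)) ≃ (Fin d → ℤ) × (Fin d → ℤ) where
  toFun x := (x.2.1, fun i => (Int.divModEquiv q).symm (-x.2.2 i, x.1 i))
  invFun y := (fun i => ((Int.divModEquiv q) (y.2 i)).2,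
    (y.1, fun i => -((Int.divModEquiv q) (y.2 i)).1))
  left_inv x := by simp only [Equiv.apply_symm_apply, neg_neg]
  right_inv y := by simp only [neg_neg, Prod.mk.eta, Equiv.symm_apply_apply]

theorem hasSum_prod_of_fintype {ι κ : Type*} [Fintype ι] {φ : ι × κ → ℝ} {S : ι → ℝ}
    (h : ∀ i, HasSum (fun k => φ (i, k)) (S i)) : HasSum φ (∑ i, S i) := by
  classical
  have h1 : ∀ i, HasSum (fun x : ι × κ => if x.1 = i then φ x else 0) (S i) := by
    intro i
    have hinj : Function.Injective fun k : κ => (i, k) := fun a b hab => congrArg Prod.snd hab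
    refine (hinj.hasSum_iff ?_).1 ?_
    · rintro ⟨j, k⟩ hx
      refine if_neg fun h => hx ⟨k, ?_⟩
      simp only at h
      rw [h]
    · simpa [Function.comp_def] using h i
  refine (hasSum_sum fun i _ => h1 i).congr_fun fun x => ?_
  simp

theorem hasSum_gaborSystem {p q : ℕ} (hq : 0 < q) {g f : Lp ℂ 2 (volume : Measure (Fin d → ℝ))}
    {F : (Fin d → ℝ) × (Fin d → ℝ) → ℂ} (hF : zakCube f =ᵐ[cubeMeasure d] F)
    {S : (Fin d → Fin q) → ℝ}
    (hS : ∀ r, HasSum (fun ml : (Fin d → ℤ) × (Fin d → ℤ) =>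
      ‖cubeCoeff (fun z => (starRingEnd ℂ) (zakWindow g p q r z) * F z)
        (ml.1, fun i => (p : ℤ) * ml.2 i)‖ ^ 2) (S r)) :
    HasSum (fun mn => ‖inner ℂ (gaborSystem g ((p : ℝ) / q) 1 mn) f‖ ^ 2) (∑ r, S r) := by
  have : NeZero q := ⟨hq.ne'⟩
  rw [← (gaborIndexEquiv d q).hasSum_iff]
  refine hasSum_prod_of_fintype fun r => ?_
  refine (hS r).congr_fun fun ml => ?_
  rw [← inner_gaborSystem hq hF]
  simp [gaborIndexEquiv, Int.divModEquiv, mul_comm]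

theorem integrable_sum_sq_zakWindow (g : Lp ℂ 2 (volume : Measure (Fin d → ℝ))) (p q : ℕ) :
    Integrable (fun z => ∑ r : Fin d → Fin q, ‖zakWindow g p q r z‖ ^ 2) (cubeMeasure d) :=
  integrable_finsetSum _ fun r _ =>
    (memLp_two_iff_integrable_sq_norm (memLp_zakWindow g p q r).1).1 (memLp_zakWindow g p q r)

/-- Indicators serve as test functions because `conj g_r · 1_S` lies in `L²` with no bound on `g_r`
known yet. -/
theorem hasSum_gaborSystem_of_indicator {p q : ℕ} (hp : 0 < p) (hq : 0 < q)
    (s : Fin d → Fin p) {g f : Lp ℂ 2 (volume : Measure (Fin d → ℝ))}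
    {S : Set ((Fin d → ℝ) × (Fin d → ℝ))} (hSm : MeasurableSet S) (hS : S ⊆ Set.univ ×ˢ box p s)
    (hF : zakCube f =ᵐ[cubeMeasure d] S.indicator fun _ => 1) :
    HasSum (fun mn => ‖inner ℂ (gaborSystem g ((p : ℝ) / q) 1 mn) f‖ ^ 2)
      (((p : ℝ) ^ d)⁻¹ * ∫ z in S, ∑ r : Fin d → Fin q, ‖zakWindow g p q r z‖ ^ 2
        ∂cubeMeasure d) := by
  have hind : ∀ r, (fun z => (starRingEnd ℂ) (zakWindow g p q r z) * S.indicator (fun _ => 1) z) =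
      S.indicator fun z => (starRingEnd ℂ) (zakWindow g p q r z) := by
    intro r
    funext z
    by_cases hz : z ∈ S <;> simp [hz]
  have hint : ∀ r, Integrable (fun z => ‖zakWindow g p q r z‖ ^ 2) (cubeMeasure d) := fun r =>
    (memLp_two_iff_integrable_sq_norm (memLp_zakWindow g p q r).1).1 (memLp_zakWindow g p q r)
  rw [integral_finsetSum _ fun r _ => (hint r).integrableOn, Finset.mul_sum]
  refine hasSum_gaborSystem hq hF fun r => ?_
  rw [hind]
  have h1 := hasSum_sq_cubeCoeff_of_box hp s
    (h := S.indicator fun z => (starRingEnd ℂ) (zakWindow g p q r z))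
    ((memLp_zakWindow g p q r).star.indicator hSm) fun z hz =>
      Set.indicator_of_notMem (fun h => hz (hS h).2) _
  have h2 : ∫ z, ‖S.indicator (fun z => (starRingEnd ℂ) (zakWindow g p q r z)) z‖ ^ 2
      ∂cubeMeasure d = ∫ z in S, ‖zakWindow g p q r z‖ ^ 2 ∂cubeMeasure d := by
    rw [← integral_indicator hSm]
    congr 1
    funext z
    by_cases hz : z ∈ S <;> simp [hz]
  rwa [h2] at h1

theorem norm_sq_of_zakCube_eq_indicator {f : Lp ℂ 2 (volume : Measure (Fin d → ℝ))}
    {S : Set ((Fin d → ℝ) × (Fin d → ℝ))} (hSm : MeasurableSet S)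
    (hF : zakCube f =ᵐ[cubeMeasure d] S.indicator fun _ => 1) :
    ‖f‖ ^ 2 = (cubeMeasure d).real S := by
  rw [← norm_zakCube, norm_sq_eq_integral, ← integral_indicator_one hSm]
  refine integral_congr_ae ?_
  filter_upwards [hF] with z hz
  rw [hz]
  by_cases h : z ∈ S <;> simp [h]

/-! ### From frame bounds to pointwise bounds, and back when `p = 1` -/

/-- Testing on every measurable subset of one slab bounds all set integrals of `∑_r |g_r|²` there,
hence the function itself a.e.; finitely many slabs cover the cube. -/
theorem ae_sum_sq_zakWindow_mem_Icc_of_frame {p q : ℕ} (hp : 0 < p) (hq : 0 < q)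
    {g : Lp ℂ 2 (volume : Measure (Fin d → ℝ))} {A B : ℝ}
    (hAB : ∀ f : Lp ℂ 2 (volume : Measure (Fin d → ℝ)),
      A * ‖f‖ ^ 2 ≤ ∑' mn, ‖inner ℂ (gaborSystem g ((p : ℝ) / q) 1 mn) f‖ ^ 2 ∧
      ∑' mn, ‖inner ℂ (gaborSystem g ((p : ℝ) / q) 1 mn) f‖ ^ 2 ≤ B * ‖f‖ ^ 2) :
    ∀ᵐ z ∂cubeMeasure d, ∑ r : Fin d → Fin q, ‖zakWindow g p q r z‖ ^ 2 ∈
      Set.Icc ((p : ℝ) ^ d * A) ((p : ℝ) ^ d * B) := by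
  have hpd : (0 : ℝ) < (p : ℝ) ^ d := by positivity
  have hW := integrable_sum_sq_zakWindow g p q
  set W : (Fin d → ℝ) × (Fin d → ℝ) → ℝ := fun z =>
    ∑ r : Fin d → Fin q, ‖zakWindow g p q r z‖ ^ 2 with hWdef
  have hbm : ∀ s : Fin d → Fin p, MeasurableSet ((Set.univ : Set (Fin d → ℝ)) ×ˢ box p s) := fun s =>
    MeasurableSet.univ.prod (measurableSet_box p s)
  have key : ∀ (s : Fin d → Fin p) (S : Set ((Fin d → ℝ) × (Fin d → ℝ))), MeasurableSet S →
      S ⊆ Set.univ ×ˢ box p s →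
      (cubeMeasure d).real S * ((p : ℝ) ^ d * A) ≤ ∫ z in S, W z ∂cubeMeasure d ∧
      ∫ z in S, W z ∂cubeMeasure d ≤ (cubeMeasure d).real S * ((p : ℝ) ^ d * B) := by
    intro s S hSm hS
    obtain ⟨f, hf⟩ := zakCube_surjective
      (indicatorConstLp 2 hSm (measure_ne_top (cubeMeasure d) S) (1 : ℂ))
    have hF : zakCube f =ᵐ[cubeMeasure d] S.indicator fun _ => 1 := by
      rw [hf]
      exact indicatorConstLp_coeFn
    obtain ⟨h1, h2⟩ := hAB f
    rw [(hasSum_gaborSystem_of_indicator (g := g) hp hq s hSm hS hF).tsum_eq,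
      norm_sq_of_zakCube_eq_indicator hSm hF] at h1 h2
    rw [← div_eq_inv_mul] at h1 h2
    rw [le_div_iff₀ hpd] at h1
    rw [div_le_iff₀ hpd] at h2
    exact ⟨by linarith, by linarith⟩
  have hbox : ∀ s : Fin d → Fin p, ∀ᵐ z ∂cubeMeasure d, z ∈ Set.univ ×ˢ box p s →
      W z ∈ Set.Icc ((p : ℝ) ^ d * A) ((p : ℝ) ^ d * B) := by
    intro s
    rw [← ae_restrict_iff' (hbm s)]
    have hlow : (fun _ => (p : ℝ) ^ d * A) ≤ᵐ[(cubeMeasure d).restrict (Set.univ ×ˢ box p s)] W := by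
      refine ae_le_of_forall_setIntegral_le (integrable_const _) hW.integrableOn fun S hS _ => ?_
      rw [Measure.restrict_restrict hS, setIntegral_const, smul_eq_mul]
      exact (key s _ (hS.inter (hbm s)) Set.inter_subset_right).1
    have hup : W ≤ᵐ[(cubeMeasure d).restrict (Set.univ ×ˢ box p s)] fun _ => (p : ℝ) ^ d * B := by
      refine ae_le_of_forall_setIntegral_le hW.integrableOn (integrable_const _) fun S hS _ => ?_
      rw [Measure.restrict_restrict hS, setIntegral_const, smul_eq_mul]
      exact (key s _ (hS.inter (hbm s)) Set.inter_subset_right).2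
    filter_upwards [hlow, hup] with z h1 h2
    exact ⟨h1, h2⟩
  have hcube : ∀ᵐ z ∂cubeMeasure d, z ∈ cube d ×ˢ cube d :=
    ae_restrict_mem (measurableSet_Icc.prod measurableSet_Icc)
  filter_upwards [ae_all_iff.2 hbox, hcube] with z h1 h2
  obtain ⟨s, hs⟩ := exists_mem_box hp h2.2
  exact h1 s ⟨trivial, hs⟩

theorem sum_sq_le_card_mul_iSup_sq {ι : Type*} [Fintype ι] (u : ι → ℝ) (hu : ∀ i, 0 ≤ u i) :
    ∑ i, u i ^ 2 ≤ Fintype.card ι * (⨆ i, u i) ^ 2 := by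
  have h := Finset.sum_le_card_nsmul Finset.univ (fun i => u i ^ 2) ((⨆ i, u i) ^ 2)
    fun i _ => pow_le_pow_left₀ (hu i) (le_ciSup (Set.finite_range u).bddAbove i) 2
  simpa using h

theorem iSup_sq_le_sum_sq {ι : Type*} [Fintype ι] [Nonempty ι] (u : ι → ℝ) :
    (⨆ i, u i) ^ 2 ≤ ∑ i, u i ^ 2 := by
  obtain ⟨i, hi⟩ := exists_eq_ciSup_of_finite (f := u)
  rw [← hi]
  exact Finset.single_le_sum (f := fun i => u i ^ 2) (fun i _ => sq_nonneg _) (Finset.mem_univ i)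

/-- With `p = 1` all frequencies occur, so Parseval needs no support condition. The bound on the
windows keeps `conj g_r · Zf` in `L²`. -/
theorem hasSum_gaborSystem_of_bounded {q : ℕ} (hq : 0 < q)
    {g f : Lp ℂ 2 (volume : Measure (Fin d → ℝ))} {B : ℝ}
    (hB : ∀ᵐ z ∂cubeMeasure d, ∀ r : Fin d → Fin q, ‖zakWindow g 1 q r z‖ ≤ B) :
    Integrable (fun z => (∑ r : Fin d → Fin q, ‖zakWindow g 1 q r z‖ ^ 2) * ‖zakCube f z‖ ^ 2)
      (cubeMeasure d) ∧
    HasSum (fun mn => ‖inner ℂ (gaborSystem g (((1 : ℕ) : ℝ) / q) 1 mn) f‖ ^ 2)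
      (∫ z, (∑ r : Fin d → Fin q, ‖zakWindow g 1 q r z‖ ^ 2) * ‖zakCube f z‖ ^ 2
        ∂cubeMeasure d) := by
  have hmem : ∀ r : Fin d → Fin q, MemLp (fun z => (starRingEnd ℂ) (zakWindow g 1 q r z) *
      zakCube f z) 2 (cubeMeasure d) := by
    intro r
    refine (Lp.memLp (zakCube f)).of_le_mul (c := B)
      ((memLp_zakWindow g 1 q r).star.1.mul (Lp.memLp (zakCube f)).1) ?_
    filter_upwards [hB] with z hz
    rw [norm_mul, RCLike.norm_conj]
    exact mul_le_mul_of_nonneg_right (hz r) (norm_nonneg _)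
  have hint := fun r => (memLp_two_iff_integrable_sq_norm (hmem r).1).1 (hmem r)
  simp only [norm_mul, mul_pow, RCLike.norm_conj] at hint
  simp only [Finset.sum_mul]
  refine ⟨integrable_finsetSum _ fun r _ => hint r, ?_⟩
  rw [integral_finsetSum _ fun r _ => hint r]
  refine hasSum_gaborSystem hq Filter.EventuallyEq.rfl fun r => ?_
  have h := hasSum_sq_cubeCoeff (hmem r)
  simp only [norm_mul, mul_pow, RCLike.norm_conj] at h
  simpa using h

end GaborZak

open GaborZak in
theorem mainTheorem7 {d p q : ℕ} (hp : 0 < p) (hpq : p < q) (hcop : Nat.Coprime p q)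
    (a : ℝ) (ha : a = (p : ℝ) / (q : ℝ))
    (g : MeasureTheory.Lp ℂ 2 (MeasureTheory.volume : MeasureTheory.Measure (Fin d → ℝ))) :
    (GaborZak.IsFrame (GaborZak.gaborSystem g a 1) →
      ∃ A B : ℝ, 0 < A ∧ ∀ᵐ z ∂(GaborZak.cubeMeasure d),
        A ≤ (⨆ j : Fin d → Fin q, ‖GaborZak.zakWindow g p q j z‖) ∧
        (⨆ j : Fin d → Fin q, ‖GaborZak.zakWindow g p q j z‖) ≤ B) ∧
    (a = 1 / (q : ℝ) →
      (∃ A B : ℝ, 0 < A ∧ ∀ᵐ z ∂(GaborZak.cubeMeasure d),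
        A ≤ (⨆ j : Fin d → Fin q, ‖GaborZak.zakWindow g p q j z‖) ∧
        (⨆ j : Fin d → Fin q, ‖GaborZak.zakWindow g p q j z‖) ≤ B) →
      GaborZak.IsFrame (GaborZak.gaborSystem g a 1)) := by
  have hq : 0 < q := hp.trans hpq
  have hq' : (0 : ℝ) < q := by exact_mod_cast hq
  have : NeZero q := ⟨hq.ne'⟩
  have hcard : (0 : ℝ) < Fintype.card (Fin d → Fin q) := by exact_mod_cast Fintype.card_pos
  subst ha
  constructor
  · rintro ⟨A, B, hA, hB, h⟩
    have hW := ae_sum_sq_zakWindow_mem_Icc_of_frame hp hq fun f => (h f).2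
    -- From `p^d A ≤ ∑_r |g_r|² ≤ q^d max²` and `max² ≤ ∑_r |g_r|² ≤ p^d B`.
    refine ⟨√((p : ℝ) ^ d * A / Fintype.card (Fin d → Fin q)), √((p : ℝ) ^ d * B), ?_, ?_⟩
    · positivity
    · filter_upwards [hW] with z hz
      constructor
      · refine Real.sqrt_le_iff.2 ⟨Real.iSup_nonneg fun r => norm_nonneg _, ?_⟩
        rw [div_le_iff₀ hcard, mul_comm _ (Fintype.card _ : ℝ)]
        exact hz.1.trans (sum_sq_le_card_mul_iSup_sq _ fun r => norm_nonneg _)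
      · exact Real.le_sqrt_of_sq_le ((iSup_sq_le_sum_sq _).trans hz.2)
  · rintro h1 ⟨A, B, hA, h⟩
    obtain rfl : p = 1 := by
      rw [div_left_inj' hq'.ne'] at h1
      exact_mod_cast h1
    have hB : ∀ᵐ z ∂cubeMeasure d, ∀ r : Fin d → Fin q, ‖zakWindow g 1 q r z‖ ≤ B := by
      filter_upwards [h] with z hz r
      exact (le_ciSup (Set.finite_range fun j => ‖zakWindow g 1 q j z‖).bddAbove r).trans hz.2
    -- The `+ 1` makes the upper constant positive without first deducing `B ≠ 0`.
    refine ⟨A ^ 2, Fintype.card (Fin d → Fin q) * B ^ 2 + 1, by positivity, by positivity,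
      fun f => ?_⟩
    obtain ⟨hint, hsum⟩ := hasSum_gaborSystem_of_bounded (f := f) hq hB
    have hf : Integrable (fun z => ‖zakCube f z‖ ^ 2) (cubeMeasure d) :=
      (memLp_two_iff_integrable_sq_norm (Lp.memLp _).1).1 (Lp.memLp (zakCube f))
    refine ⟨hsum.summable, ?_, ?_⟩
    · rw [hsum.tsum_eq, ← norm_zakCube, norm_sq_eq_integral, ← integral_const_mul]
      refine integral_mono_ae (hf.const_mul _) hint ?_
      filter_upwards [h] with z hz
      exact mul_le_mul_of_nonneg_right
        ((pow_le_pow_left₀ hA.le hz.1 2).trans (iSup_sq_le_sum_sq _)) (sq_nonneg _)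
    · rw [hsum.tsum_eq, ← norm_zakCube, norm_sq_eq_integral, ← integral_const_mul]
      refine integral_mono_ae hint (hf.const_mul _) ?_
      filter_upwards [h] with z hz
      refine mul_le_mul_of_nonneg_right ?_ (sq_nonneg _)
      refine ((sum_sq_le_card_mul_iSup_sq _ fun r => norm_nonneg _).trans
        (mul_le_mul_of_nonneg_left (pow_le_pow_left₀ ?_ hz.2 2) hcard.le)).trans
        (le_add_of_nonneg_right zero_le_one)
      exact Real.iSup_nonneg fun r => norm_nonneg _
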